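/- Let $d\ge 1$ be an integer and $s>0$, and set $p_*=p_*(s,d)=\frac{2d}{d-2s}$ if $s<d/2$ and $p_*=\infty$ if $s\ge d/2$. Let $\mathcal F$ be the Fourier transform on $L^2(\mathbb R^d)$ (all functions are complex-valued), with $(\mathcal Ff)(\xi)=\int_{\mathbb R^d}e^{-2\pi i x\cdot\xi}f(x)\,dx$ for Schwartz functions. Let $H^s(\mathbb R^d)$ be the $L^2$-Sobolev space with norm $\|f\|_{H^s}^2=\int_{\mathbb R^d}(1+|2\pi\xi|^2)^s|\mathcal Ff(\xi)|^2\,d\xi$. For a measurable $A\subset\mathbb R^d$ of finite measure let $A^*$ be the open ball centred at $0$ with $|A^*|=|A|$ ($A^*=\emptyset$ if $|A|=0$); for a measurable $g:\mathbb R^d\to\mathbb C$ with $|\{|g|>t\}|<\infty$ for all $t>0$ let $g^*(x)=\int_0^\infty \mathbf 1_{\{|g|>t\}^*}(x)\,dt$ be its symmetric-decreasing rearrangement. For $f\in L^2(\mathbb R^d)$ let $f^\sharp=\mathcal F^{-1}\{(\mathcal Ff)^*\}\in L^2(\mathbb R^d)$ be its Fourier rearrangement, and let $H^{s,\sharp}(\mathbb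 R^d)=\{f\in H^s(\mathbb R^d): f=f^\sharp\}$. **Lemma.** The set $H^{s,\sharp}(\mathbb R^d)$ is compactly embedded in $L^p(\mathbb R^d)$ for every $2<p<p_*$; that is, $H^{s,\sharp}(\mathbb R^d)\subset L^p(\mathbb R^d)$, there is a constant $C$ with $\|f-g\|_{L^p}\le C\|f-g\|_{H^s}$ for all $f,g\in H^{s,\sharp}(\mathbb R^d)$, and every sequence in $H^{s,\sharp}(\mathbb R^d)$ that is bounded in $H^s(\mathbb R^d)$ has a subsequence that converges strongly in $L^p(\mathbb R^d)$. More precisely, if $(f_k)$ is a bounded sequence in $H^s(\mathbb R^d)$ with $f_k=f_k^\sharp$ for all $k$, then there exist a subsequence $(f_{k_m})$ and some $f\in H^{s,\sharp}(\mathbb R^d)$, both independent of $p$, such that, for every $2<p<p_*$, $f\in L^p(\mathbb R^d)$ and $f_{k_m}\to f$ strongly in $L^p(\mathbb R^d)$ as $m\to\infty$. -/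

import Mathlib

open MeasureTheory Set Filter Topology
open scoped ENNReal NNReal FourierTransform SchwartzMap

noncomputable section

namespace FourierRearr

/-- Euclidean space `ℝ^d`. -/
abbrev Space (d : ℕ) : Type := EuclideanSpace ℝ (Fin d)

/-- The Hilbert space `L²(ℝ^d)` of (classes of) complex-valued functions. -/
abbrev L2 (d : ℕ) : Type := Lp ℂ 2 (volume : Measure (Space d))

/-! ### Symmetric-decreasing rearrangement -/

/-- The radius `R ≥ 0` with `|B_R(0)| = |A|`, for a set `A ⊆ ℝ^d` of finite measure. -/
def ballRadius {d : ℕ} (A : Set (Space d)) : ℝ :=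
  (volume A / volume (Metric.ball (0 : Space d) 1)).toReal ^ ((d : ℝ)⁻¹)

/-- `A^*`: the open ball centred at the origin with the same measure as `A`
(the empty set if `A` is a null set). -/
def setRearr {d : ℕ} (A : Set (Space d)) : Set (Space d) :=
  Metric.ball 0 (ballRadius A)

/-- The defining property of `A^*`. -/
theorem volume_setRearr {d : ℕ} [NeZero d] (A : Set (Space d)) (hA : volume A ≠ ∞) :
    volume (setRearr A) = volume A := by
  have hd : (d : ℝ) ≠ 0 := Nat.cast_ne_zero.mpr (NeZero.ne d)
  have hb0 : volume (Metric.ball (0 : Space d) 1) ≠ 0 :=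
    (Metric.measure_ball_pos volume 0 one_pos).ne'
  have hbt : volume (Metric.ball (0 : Space d) 1) ≠ ∞ := measure_ball_lt_top.ne
  have hne : Nonempty (Fin d) := ⟨⟨0, Nat.pos_of_ne_zero (NeZero.ne d)⟩⟩
  have hR : 0 ≤ ballRadius A := Real.rpow_nonneg ENNReal.toReal_nonneg _
  rw [setRearr, Measure.addHaar_ball volume 0 hR]
  have h1 : ballRadius A ^ Module.finrank ℝ (Space d)
      = (volume A / volume (Metric.ball (0 : Space d) 1)).toReal := by
    rw [finrank_euclideanSpace_fin, ballRadius, ← Real.rpow_natCast,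
      ← Real.rpow_mul ENNReal.toReal_nonneg, inv_mul_cancel₀ hd, Real.rpow_one]
  rw [h1, ENNReal.ofReal_toReal (ENNReal.div_ne_top hA hb0), ENNReal.div_mul_cancel hb0 hbt]

/-- The symmetric-decreasing rearrangement `g^*(x) = ∫₀^∞ 1_{{|g| > t}^*}(x) dt`. It takes values in
`[0, ∞]`; for `g` vanishing at infinity the value `∞` can occur only at the origin. -/
def symmRearr {d : ℕ} (g : Space d → ℂ) (x : Space d) : ℝ≥0∞ :=
  ∫⁻ t in Ioi (0 : ℝ), (setRearr {y | t < ‖g y‖}).indicator 1 x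

theorem measurable_symmRearr {d : ℕ} (g : Space d → ℂ) : Measurable (symmRearr g) := by
  have hm : Measurable fun t : ℝ => volume {y | t < ‖g y‖} :=
    Antitone.measurable fun a b hab => measure_mono fun y (hy : b < ‖g y‖) => hab.trans_lt hy
  have hR : Measurable fun t : ℝ => ballRadius {y | t < ‖g y‖} := by
    unfold ballRadius
    exact ((hm.div_const _).ennreal_toReal).pow_const _
  have hS : MeasurableSet {q : Space d × ℝ | ‖q.1‖ < ballRadius {y | q.2 < ‖g y‖}} :=
    measurableSet_lt measurable_fst.norm (hR.comp measurable_snd)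
  have hF : Measurable fun q : Space d × ℝ =>
      (setRearr {y | q.2 < ‖g y‖}).indicator (1 : Space d → ℝ≥0∞) q.1 := by
    have h2 : (fun q : Space d × ℝ =>
        (setRearr {y | q.2 < ‖g y‖}).indicator (1 : Space d → ℝ≥0∞) q.1)
        = {q : Space d × ℝ | ‖q.1‖ < ballRadius {y | q.2 < ‖g y‖}}.indicator 1 := by
      funext q
      simp only [Set.indicator, setRearr, mem_ball_zero_iff, mem_ofPred_eq, Pi.one_apply]
    rw [h2]
    exact measurable_one.indicator hS
  exact hF.lintegral_prod_right'

/-- Rearrangement preserves square-integrability. -/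
theorem memLp_symmRearr {d : ℕ} [NeZero d] (g : Space d → ℂ) (hg : MemLp g 2 volume) :
    MemLp (fun x => ((symmRearr g x).toReal : ℂ)) 2 volume := by
  have hmeas := measurable_symmRearr g
  have hfin : ∀ t : ℝ, 0 < t → volume {y | t < ‖g y‖} ≠ ∞ := fun t ht => by
    have := hg.meas_ge_lt_top (by norm_num) (by norm_num) (ε := ⟨t, ht.le⟩)
      (fun h => ht.ne' (congrArg NNReal.toReal h))
    refine (lt_of_le_of_lt (measure_mono fun y hy => ?_) this).ne
    exact_mod_cast (le_of_lt hy : t ≤ ‖g y‖)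
  have hsub : ∀ τ : ℝ, 0 < τ →
      {x | τ < (symmRearr g x).toReal} ⊆ setRearr {y | τ < ‖g y‖} := by
    intro τ hτ x hx
    by_contra hnot
    have hle : symmRearr g x ≤ ENNReal.ofReal τ := by
      calc symmRearr g x
          ≤ ∫⁻ t in Ioi (0 : ℝ), (Ioc (0 : ℝ) τ).indicator 1 t := by
            refine setLIntegral_mono (measurable_one.indicator measurableSet_Ioc) fun t ht => ?_
            by_cases hxt : x ∈ setRearr {y | t < ‖g y‖}
            · have htτ : t ≤ τ := by
                by_contra! hlt
                refine hnot (Metric.ball_subset_ball ?_ hxt)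
                refine Real.rpow_le_rpow ENNReal.toReal_nonneg ?_ (by positivity)
                refine ENNReal.toReal_mono (ENNReal.div_ne_top (hfin τ hτ)
                  (Metric.measure_ball_pos volume 0 one_pos).ne') ?_
                exact ENNReal.div_le_div_right
                  (measure_mono fun y (hy : t < ‖g y‖) => hlt.trans hy) _
              have : t ∈ Ioc (0 : ℝ) τ := ⟨ht, htτ⟩
              simp [hxt, this]
            · simp [hxt]
        _ ≤ ∫⁻ t, (Ioc (0 : ℝ) τ).indicator 1 t := setLIntegral_le_lintegral _ _
        _ = ENNReal.ofReal τ := by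
            rw [lintegral_indicator_one measurableSet_Ioc, Real.volume_Ioc, sub_zero]
    have := ENNReal.toReal_mono ENNReal.ofReal_ne_top hle
    rw [ENNReal.toReal_ofReal hτ.le] at this
    exact absurd hx (not_lt.mpr this)
  have hle : ∀ τ : ℝ, 0 < τ →
      volume {x | τ < (symmRearr g x).toReal} ≤ volume {y | τ < ‖g y‖} := fun τ hτ =>
    (measure_mono (hsub τ hτ)).trans (volume_setRearr _ (hfin τ hτ)).le
  have hint : ∫⁻ x, ENNReal.ofReal ((symmRearr g x).toReal ^ (2 : ℝ))
      ≤ ∫⁻ x, ENNReal.ofReal (‖g x‖ ^ (2 : ℝ)) := by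
    rw [lintegral_rpow_eq_lintegral_meas_lt_mul volume
        (Eventually.of_forall fun _ => ENNReal.toReal_nonneg)
        hmeas.ennreal_toReal.aemeasurable two_pos,
      lintegral_rpow_eq_lintegral_meas_lt_mul volume
        (Eventually.of_forall fun _ => norm_nonneg _)
        hg.1.norm.aemeasurable two_pos]
    gcongr ENNReal.ofReal 2 * ?_
    refine setLIntegral_mono' measurableSet_Ioi fun t ht => ?_
    exact mul_le_mul_left (hle t ht) _
  have hcv : ∀ a : ℝ, 0 ≤ a → ENNReal.ofReal (a ^ (2 : ℝ)) = ENNReal.ofReal a ^ (2 : ℝ) :=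
    fun a ha => (ENNReal.ofReal_rpow_of_nonneg ha two_pos.le).symm
  refine ⟨(Complex.measurable_ofReal.comp hmeas.ennreal_toReal).aestronglyMeasurable, ?_⟩
  have hg2 := hg.2
  rw [eLpNorm_lt_top_iff_lintegral_rpow_enorm_lt_top (by norm_num) (by norm_num)] at hg2 ⊢
  refine lt_of_le_of_lt ?_ hg2
  simp only [ENNReal.toReal_ofNat]
  calc ∫⁻ x, ‖((symmRearr g x).toReal : ℂ)‖ₑ ^ (2 : ℝ)
      = ∫⁻ x, ENNReal.ofReal ((symmRearr g x).toReal ^ (2 : ℝ)) := by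
        refine lintegral_congr fun x => ?_
        rw [hcv _ ENNReal.toReal_nonneg, ← ofReal_norm, Complex.norm_real, Real.norm_eq_abs,
          abs_of_nonneg ENNReal.toReal_nonneg]
    _ ≤ ∫⁻ x, ENNReal.ofReal (‖g x‖ ^ (2 : ℝ)) := hint
    _ = ∫⁻ x, ‖g x‖ₑ ^ (2 : ℝ) := by
        refine lintegral_congr fun x => ?_
        rw [hcv _ (norm_nonneg _), ofReal_norm]

/-- The Fourier rearrangement `f^♯ = 𝓕⁻¹ {(𝓕 f)^*}` of `f ∈ L²(ℝ^d)`. -/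
def fourierRearr {d : ℕ} [NeZero d] (f : L2 d) : L2 d :=
  𝓕⁻ ((memLp_symmRearr (𝓕 f : L2 d) (Lp.memLp (𝓕 f : L2 d))).toLp)

/-! ### Sobolev spaces -/

/-- The Sobolev space `H^s(ℝ^d)`, `s ≥ 0`, as a subset of `L²(ℝ^d)`. -/
def Hs (d : ℕ) (s : ℝ) : Set (L2 d) :=
  {f | TemperedDistribution.MemSobolev s 2 (f : 𝓢'(Space d, ℂ))}

/-- The norm `‖f‖_{H^s} = (∫ (1 + |2πξ|²)^s |(𝓕 f)(ξ)|² dξ)^{1/2}`, which is `∞` if `f ∉ H^s`. -/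
def sobolevNorm {d : ℕ} (s : ℝ) (f : L2 d) : ℝ≥0∞ :=
  (∫⁻ ξ, ENNReal.ofReal ((1 + ‖(2 * Real.pi) • ξ‖ ^ 2) ^ s) * ‖(𝓕 f : L2 d) ξ‖ₑ ^ 2) ^ (1 / 2 : ℝ)

/-- `H^{s,♯}(ℝ^d) = {f ∈ H^s(ℝ^d) : f = f^♯}`. -/
def HsSharp (d : ℕ) [NeZero d] (s : ℝ) : Set (L2 d) :=
  {f | f ∈ Hs d s ∧ f = fourierRearr f}

/-- The critical exponent: `2d/(d-2s)` if `s < d/2`, and `∞` if `s ≥ d/2`. -/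
def pStar (s : ℝ) (d : ℕ) : ℝ≥0∞ :=
  if s < d / 2 then ENNReal.ofReal (2 * d / (d - 2 * s)) else ∞

/-- A subset `K` of `H^s(ℝ^d)` is compactly embedded in `L^p(ℝ^d)`: it is contained in `L^p`, the
inclusion is Lipschitz for the two norms, and each sequence in `K` that is bounded in `H^s` has a
subsequence that converges in `L^p`. -/
def CompactlyEmbedded {d : ℕ} (s : ℝ) (p : ℝ≥0∞) (K : Set (L2 d)) : Prop :=
  (∀ f ∈ K, MemLp f p volume) ∧
  (∃ C : ℝ≥0, ∀ f ∈ K, ∀ g ∈ K, eLpNorm (f - g : L2 d) p volume ≤ C * sobolevNorm s (f - g)) ∧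
  ∀ f : ℕ → L2 d, (∀ k, f k ∈ K) → (∃ M : ℝ≥0, ∀ k, sobolevNorm s (f k) ≤ M) →
    ∃ φ : ℕ → ℕ, StrictMono φ ∧ ∃ h : Space d → ℂ, MemLp h p volume ∧
      Tendsto (fun m => eLpNorm (fun x => f (φ m) x - h x) p volume) atTop (𝓝 0)

end FourierRearr

end

/-! Since `f k = (f k)^♯`, the Fourier transform of each `f k` is a radially decreasing function,
and Helly's selection theorem provides a subsequence along which these functions converge almost
everywhere. With `m(ξ) = (1 + |2πξ|²)^{s/2}`, the functions `m · 𝓕 (f k)` are bounded in `L²`,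
while `m⁻¹ ∈ L^r` precisely because `p < p_*`, where `1/r = 1/q - 1/2` and `q` is the exponent
conjugate to `p`. By Hölder's inequality the functions `𝓕 (f k)` are therefore uniformly
integrable and tight in `L^q`, so Vitali's theorem upgrades the almost everywhere convergence to
convergence in `L^q`. The Hausdorff–Young inequality turns it into convergence of `f k` in `L^p`.
That inequality, with some constant, follows by real interpolation between `L¹ → L^∞` and
`L² → L²`: bound the measure of `{|𝓕⁻ v| > t}` by cutting `v` at a height that depends on `t`, and
integrate over `t`. -/

noncomputable section

namespace FourierRearr

section HausdorffYoung

variable {α G : Type*} [MeasurableSpace α] {μ : Measure α} [NormedAddCommGroup G]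

theorem setLIntegral_enorm_le_of_lintegral_rpow_le {f : α → G} (hf : StronglyMeasurable f)
    {q c N t : ℝ} (hc : 0 < c) (hN : 0 < N) (ht : 0 < t)
    (hfN : ∫⁻ x, ENNReal.ofReal (‖f x‖ ^ q) ∂μ ≤ ENNReal.ofReal N) :
    ∫⁻ x in {x | c * N * ‖f x‖ ^ (1 - q) < t}, ‖f x‖ₑ ∂μ ≤ ENNReal.ofReal (t / c) := by
  have hA : MeasurableSet {x | c * N * ‖f x‖ ^ (1 - q) < t} :=
    measurableSet_lt ((hf.norm.measurable.pow_const _).const_mul _) measurable_const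
  calc ∫⁻ x in {x | c * N * ‖f x‖ ^ (1 - q) < t}, ‖f x‖ₑ ∂μ
      ≤ ∫⁻ x in {x | c * N * ‖f x‖ ^ (1 - q) < t},
          ENNReal.ofReal (t / (c * N)) * ENNReal.ofReal (‖f x‖ ^ q) ∂μ := by
        refine setLIntegral_mono' hA fun x (hx : _ < t) => ?_
        rcases (norm_nonneg (f x)).eq_or_lt' with h₀ | h₀
        · simp [← ofReal_norm, h₀]
        rw [← ofReal_norm, ← ENNReal.ofReal_mul (by positivity)]
        gcongr
        calc ‖f x‖ = (c * N * ‖f x‖ ^ (1 - q)) / (c * N) * ‖f x‖ ^ q := by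
              rw [mul_div_cancel_left₀ _ (by positivity), ← Real.rpow_add h₀, sub_add_cancel,
                Real.rpow_one]
          _ ≤ t / (c * N) * ‖f x‖ ^ q := by gcongr
    _ ≤ ENNReal.ofReal (t / (c * N)) * ENNReal.ofReal N := by
        rw [lintegral_const_mul' _ _ ENNReal.ofReal_ne_top]
        gcongr
        exact (setLIntegral_le_lintegral _ _).trans hfN
    _ = ENNReal.ofReal (t / c) := by
        rw [← ENNReal.ofReal_mul (by positivity)]
        congr 1
        field_simp

theorem eLpNorm_rpow_toReal_eq_lintegral {p : ℝ≥0∞} (hp₀ : p ≠ 0) (hp : p ≠ ∞) (f : α → G) :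
    eLpNorm f p μ ^ p.toReal = ∫⁻ x, ENNReal.ofReal (‖f x‖ ^ p.toReal) ∂μ := by
  have hpos := ENNReal.toReal_pos hp₀ hp
  rw [eLpNorm_eq_lintegral_rpow_enorm_toReal hp₀ hp, ← ENNReal.rpow_mul,
    one_div_mul_cancel hpos.ne', ENNReal.rpow_one]
  simp only [← ofReal_norm, ENNReal.ofReal_rpow_of_nonneg (norm_nonneg _) hpos.le]

variable {E F : Type*} [NormedAddCommGroup E] [InnerProductSpace ℝ E] [FiniteDimensional ℝ E]
  [MeasurableSpace E] [BorelSpace E]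

theorem ae_eq_of_forall_integral_schwartzMap_smul_eq [NormedAddCommGroup F] [NormedSpace ℂ F]
    [CompleteSpace F] {f g : E → F} (hf : LocallyIntegrable f) (hg : LocallyIntegrable g)
    (h : ∀ φ : 𝓢(E, ℂ), ∫ x, φ x • f x = ∫ x, φ x • g x) : f =ᵐ[volume] g := by
  refine ae_eq_of_integral_contDiff_smul_eq hf hg fun φ hφ hφc => ?_
  have hc : HasCompactSupport (Complex.ofRealCLM ∘ φ) := hφc.comp_left rfl
  simpa using h (hc.toSchwartzMap (Complex.ofRealCLM.contDiff.comp hφ))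

variable [NormedAddCommGroup F] [InnerProductSpace ℂ F] [CompleteSpace F]

theorem coeFn_fourierInv_ae_eq_of_integrable (v : Lp F 2 (volume : Measure E))
    (hv : Integrable v) :
    ⇑(𝓕⁻ v : Lp F 2 (volume : Measure E)) =ᵐ[volume] 𝓕⁻ (v : E → F) := by
  have hcont : Continuous fun p : E × E => (-innerₗ E) p.1 p.2 := by
    simp only [LinearMap.neg_apply, innerₗ_apply_apply]
    fun_prop
  have hflip : (-innerₗ E : E →ₗ[ℝ] E →ₗ[ℝ] ℝ).flip = -innerₗ E := by
    ext x y
    simp [real_inner_comm]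
  have hFv : Continuous (𝓕⁻ (v : E → F)) :=
    VectorFourier.fourierIntegral_continuous Real.continuous_fourierChar hcont hv
  refine ae_eq_of_forall_integral_schwartzMap_smul_eq
    ((Lp.memLp _).locallyIntegrable (by norm_num)) hFv.locallyIntegrable fun φ => ?_
  calc ∫ x, φ x • (𝓕⁻ v : Lp F 2 (volume : Measure E)) x
      = ∫ ξ, (𝓕⁻ φ : 𝓢(E, ℂ)) ξ • v ξ := by
        rw [← Lp.toTemperedDistribution_apply, ← Lp.toTemperedDistribution_apply,
          ← Lp.fourierInv_toTemperedDistribution_eq]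
        rfl
    _ = ∫ x, φ x • 𝓕⁻ (v : E → F) x := by
        have := VectorFourier.integral_fourierIntegral_smul_eq_flip (L := -innerₗ E)
          Real.continuous_fourierChar hcont (φ.integrable (μ := volume)) hv
        rw [hflip] at this
        rw [SchwartzMap.fourierInv_coe]
        exact this

theorem ae_norm_fourierInv_le_integral_norm (v : Lp F 2 (volume : Measure E))
    (hv : Integrable v) :
    ∀ᵐ x, ‖(𝓕⁻ v : Lp F 2 (volume : Measure E)) x‖ ≤ ∫ ξ, ‖v ξ‖ := by
  filter_upwards [coeFn_fourierInv_ae_eq_of_integrable v hv] with x hx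
  rw [hx]
  exact VectorFourier.norm_fourierIntegral_le_integral_norm _ _ _ _ _

theorem norm_fourierInv_eq (v : Lp F 2 (volume : Measure E)) : ‖𝓕⁻ v‖ = ‖v‖ :=
  (Lp.fourierTransformₗᵢ E F).symm.norm_map v

-- The `L¹` bound keeps `𝓕⁻ v₁` below `t / 2`, so `𝓕⁻ v₂` exceeds `t / 2` wherever the sum exceeds
-- `t`; Chebyshev and Plancherel bound the measure of that set.
theorem volume_lt_norm_fourierInv_add_le (v₁ v₂ : Lp F 2 (volume : Measure E)) {t : ℝ}
    (ht : 0 < t) (hv₁ : Integrable v₁) (hv₁t : ∫ ξ, ‖v₁ ξ‖ ≤ t / 2) :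
    volume {x | t < ‖(𝓕⁻ (v₁ + v₂) : Lp F 2 (volume : Measure E)) x‖}
      ≤ ENNReal.ofReal (4 / t ^ 2) * ‖v₂‖ₑ ^ 2 := by
  have hsub : ∀ᵐ x, t < ‖(𝓕⁻ (v₁ + v₂) : Lp F 2 (volume : Measure E)) x‖ →
      ENNReal.ofReal (t / 2) ≤ ‖(𝓕⁻ v₂ : Lp F 2 (volume : Measure E)) x‖ₑ := by
    rw [FourierTransform.fourierInv_add]
    filter_upwards [ae_norm_fourierInv_le_integral_norm v₁ hv₁,
      Lp.coeFn_add (𝓕⁻ v₁) (𝓕⁻ v₂)] with x hx hadd hlt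
    rw [hadd, Pi.add_apply] at hlt
    rw [← ofReal_norm]
    gcongr
    linarith [norm_add_le ((𝓕⁻ v₁ : Lp F 2 (volume : Measure E)) x)
      ((𝓕⁻ v₂ : Lp F 2 (volume : Measure E)) x)]
  have hcheb := mul_meas_ge_le_pow_eLpNorm' volume two_ne_zero ENNReal.ofNat_ne_top
    (Lp.aestronglyMeasurable (𝓕⁻ v₂ : Lp F 2 (volume : Measure E))) (ENNReal.ofReal (t / 2))
  rw [← Lp.enorm_def, ← ofReal_norm, norm_fourierInv_eq, ofReal_norm, ENNReal.toReal_ofNat,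
    ENNReal.rpow_ofNat, ENNReal.rpow_ofNat] at hcheb
  have hinv : ENNReal.ofReal (4 / t ^ 2) * ENNReal.ofReal (t / 2) ^ 2 = 1 := by
    rw [← ENNReal.ofReal_pow (by positivity), ← ENNReal.ofReal_mul (by positivity),
      ← ENNReal.ofReal_one]
    congr 1
    field_simp
    norm_num
  calc volume {x | t < ‖(𝓕⁻ (v₁ + v₂) : Lp F 2 (volume : Measure E)) x‖}
      ≤ volume {x | ENNReal.ofReal (t / 2) ≤ ‖(𝓕⁻ v₂ : Lp F 2 (volume : Measure E)) x‖ₑ} :=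
        measure_mono_ae hsub
    _ = ENNReal.ofReal (4 / t ^ 2) * (ENNReal.ofReal (t / 2) ^ 2 *
          volume {x | ENNReal.ofReal (t / 2) ≤ ‖(𝓕⁻ v₂ : Lp F 2 (volume : Measure E)) x‖ₑ}) := by
        rw [← mul_assoc, hinv, one_mul]
    _ ≤ ENNReal.ofReal (4 / t ^ 2) * ‖v₂‖ₑ ^ 2 := by gcongr

theorem volume_lt_norm_fourierInv_le (v : Lp F 2 (volume : Measure E)) {A : Set E}
    (hA : MeasurableSet A) {t : ℝ} (ht : 0 < t)
    (hvt : ∫⁻ ξ in Aᶜ, ‖v ξ‖ₑ ≤ ENNReal.ofReal (t / 2)) :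
    volume {x | t < ‖(𝓕⁻ v : Lp F 2 (volume : Measure E)) x‖}
      ≤ ENNReal.ofReal (4 / t ^ 2) * ∫⁻ ξ in A, ‖v ξ‖ₑ ^ 2 := by
  have hfar : MemLp (Aᶜ.indicator v) 2 := (Lp.memLp v).indicator hA.compl
  have hnear : MemLp (A.indicator v) 2 := (Lp.memLp v).indicator hA
  have hadd : v = hfar.toLp _ + hnear.toLp _ := by
    rw [← MemLp.toLp_add]
    simp only [indicator_compl_add_self, Lp.toLp_coeFn]
  have hfar_lintegral : ∫⁻ ξ, ‖hfar.toLp _ ξ‖ₑ ≤ ENNReal.ofReal (t / 2) := by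
    refine (lintegral_congr_ae (hfar.coeFn_toLp.fun_comp (‖·‖ₑ))).trans_le ?_
    simpa only [Function.comp_apply, enorm_indicator_eq_indicator_enorm,
      lintegral_indicator hA.compl] using hvt
  have hfar_integral : ∫ ξ, ‖hfar.toLp _ ξ‖ ≤ t / 2 := by
    rw [integral_norm_eq_lintegral_enorm (Lp.aestronglyMeasurable _)]
    exact ENNReal.toReal_le_of_le_ofReal (by positivity) hfar_lintegral
  have hnear_enorm : ‖hnear.toLp _‖ₑ ^ 2 = ∫⁻ ξ in A, ‖v ξ‖ₑ ^ 2 := by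
    rw [Lp.enorm_toLp, eLpNorm_indicator_eq_eLpNorm_restrict hA]
    simpa using eLpNorm_nnreal_pow_eq_lintegral (p := 2) (f := v) two_ne_zero
  conv_lhs => rw [hadd]
  rw [← hnear_enorm]
  exact volume_lt_norm_fourierInv_add_le _ _ ht
    ⟨Lp.aestronglyMeasurable _, hfar_lintegral.trans_lt ENNReal.ofReal_lt_top⟩ hfar_integral

theorem volume_lt_norm_fourierInv_mul_rpow_le (v : Lp F 2 (volume : Measure E)) {A : Set E}
    (hA : MeasurableSet A) {t : ℝ} (ht : 0 < t)
    (hvt : ∫⁻ ξ in Aᶜ, ‖v ξ‖ₑ ≤ ENNReal.ofReal (t / 2)) (p : ℝ) :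
    volume {x | t < ‖(𝓕⁻ v : Lp F 2 (volume : Measure E)) x‖} * ENNReal.ofReal (t ^ (p - 1))
      ≤ ENNReal.ofReal 4 * ((∫⁻ ξ in A, ‖v ξ‖ₑ ^ 2) * ENNReal.ofReal (t ^ (p - 2 - 1))) := by
  have hpow : ENNReal.ofReal (4 / t ^ 2) * ENNReal.ofReal (t ^ (p - 1))
      = ENNReal.ofReal 4 * ENNReal.ofReal (t ^ (p - 2 - 1)) := by
    rw [← ENNReal.ofReal_mul (by positivity), ← ENNReal.ofReal_mul (by positivity),
      show p - 1 = p - 2 - 1 + (2 : ℕ) by push_cast; ring, Real.rpow_add ht, Real.rpow_natCast]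
    congr 1
    field_simp
  calc volume {x | t < ‖(𝓕⁻ v : Lp F 2 (volume : Measure E)) x‖} * ENNReal.ofReal (t ^ (p - 1))
      ≤ ENNReal.ofReal (4 / t ^ 2) * (∫⁻ ξ in A, ‖v ξ‖ₑ ^ 2) * ENNReal.ofReal (t ^ (p - 1)) := by
        gcongr
        exact volume_lt_norm_fourierInv_le v hA ht hvt
    _ = ENNReal.ofReal (4 / t ^ 2) * ENNReal.ofReal (t ^ (p - 1)) * ∫⁻ ξ in A, ‖v ξ‖ₑ ^ 2 := by
        ring
    _ = ENNReal.ofReal 4 * ((∫⁻ ξ in A, ‖v ξ‖ₑ ^ 2) * ENNReal.ofReal (t ^ (p - 2 - 1))) := by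
        rw [hpow]
        ring

theorem lintegral_fourierInv_rpow_le_of_splitting {p : ℝ} (hp : 2 < p)
    (v : Lp F 2 (volume : Measure E)) {B : E → ℝ} (hB : Measurable B) (hB₀ : 0 ≤ B)
    (hvB : ∀ t > 0, ∫⁻ ξ in {ξ | B ξ < t}, ‖v ξ‖ₑ ≤ ENNReal.ofReal (t / 2)) :
    ∫⁻ x, ENNReal.ofReal (‖(𝓕⁻ v : Lp F 2 (volume : Measure E)) x‖ ^ p)
      ≤ ENNReal.ofReal (4 * p / (p - 2)) * ∫⁻ ξ, ‖v ξ‖ₑ ^ 2 * ENNReal.ofReal (B ξ ^ (p - 2)) := by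
  have hp₂ : 0 < p - 2 := by linarith
  have hv : AEMeasurable (fun ξ => ‖v ξ‖ₑ ^ 2) volume :=
    (Lp.aestronglyMeasurable v).enorm.pow_const 2
  set ν : Measure E := volume.withDensity fun ξ => ‖v ξ‖ₑ ^ 2
  have hlevel (t : ℝ) : MeasurableSet {ξ | t ≤ B ξ} := measurableSet_le measurable_const hB
  have htail (t : ℝ) (ht : 0 < t) :
      volume {x | t < ‖(𝓕⁻ v : Lp F 2 (volume : Measure E)) x‖} * ENNReal.ofReal (t ^ (p - 1))
        ≤ ENNReal.ofReal 4 * (ν {ξ | t ≤ B ξ} * ENNReal.ofReal (t ^ (p - 2 - 1))) := by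
    rw [withDensity_apply _ (hlevel t)]
    refine volume_lt_norm_fourierInv_mul_rpow_le v (hlevel t) ht ?_ p
    simpa only [compl_ofPred, not_le] using hvB t ht
  calc ∫⁻ x, ENNReal.ofReal (‖(𝓕⁻ v : Lp F 2 (volume : Measure E)) x‖ ^ p)
      = ENNReal.ofReal p * ∫⁻ t in Ioi 0,
          volume {x | t < ‖(𝓕⁻ v : Lp F 2 (volume : Measure E)) x‖} *
            ENNReal.ofReal (t ^ (p - 1)) :=
        lintegral_rpow_eq_lintegral_meas_lt_mul volume (Eventually.of_forall fun _ => norm_nonneg _)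
          (Lp.aestronglyMeasurable _).norm.aemeasurable (by linarith)
    _ ≤ ENNReal.ofReal p * (ENNReal.ofReal 4 * ∫⁻ t in Ioi 0,
          ν {ξ | t ≤ B ξ} * ENNReal.ofReal (t ^ (p - 2 - 1))) := by
        rw [← lintegral_const_mul' (ENNReal.ofReal 4) _ ENNReal.ofReal_ne_top]
        gcongr ENNReal.ofReal p * ?_
        exact setLIntegral_mono' measurableSet_Ioi htail
    _ = ENNReal.ofReal (4 * p / (p - 2)) * ∫⁻ ξ, ENNReal.ofReal (B ξ ^ (p - 2)) ∂ν := by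
        rw [lintegral_rpow_eq_lintegral_meas_le_mul ν (Eventually.of_forall hB₀) hB.aemeasurable
          hp₂, ← mul_assoc, ← mul_assoc, ← ENNReal.ofReal_mul (by linarith),
          ← ENNReal.ofReal_mul (by positivity)]
        congr 2
        field_simp
    _ = _ := by
        rw [lintegral_withDensity_eq_lintegral_mul₀ hv (by fun_prop)]
        rfl

theorem lintegral_fourierInv_rpow_le {p q : ℝ} (hpq : p.HolderConjugate q) (hp : 2 < p)
    (v : Lp F 2 (volume : Measure E)) {N : ℝ} (hN : 0 < N)
    (hv : ∫⁻ ξ, ENNReal.ofReal (‖v ξ‖ ^ q) ≤ ENNReal.ofReal N) :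
    ∫⁻ x, ENNReal.ofReal (‖(𝓕⁻ v : Lp F 2 (volume : Measure E)) x‖ ^ p)
      ≤ ENNReal.ofReal (4 * p / (p - 2) * 2 ^ (p - 2) * N ^ (p - 1)) := by
  have hvm := Lp.stronglyMeasurable v
  have hweight (ξ : E) : ‖v ξ‖ₑ ^ 2 * ENNReal.ofReal ((2 * N * ‖v ξ‖ ^ (1 - q)) ^ (p - 2))
      = ENNReal.ofReal ((2 * N) ^ (p - 2)) * ENNReal.ofReal (‖v ξ‖ ^ q) := by
    rcases (norm_nonneg (v ξ)).eq_or_lt' with h₀ | h₀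
    · simp [← ofReal_norm, h₀, Real.zero_rpow hpq.symm.pos.ne']
    have hexp : 2 + (1 - q) * (p - 2) = q := by linarith [hpq.mul_eq_add]
    rw [← ofReal_norm, ← ENNReal.ofReal_pow h₀.le, ← ENNReal.ofReal_mul (by positivity),
      ← ENNReal.ofReal_mul (by positivity), Real.mul_rpow (by positivity) (by positivity),
      ← Real.rpow_mul h₀.le, mul_left_comm, ← Real.rpow_natCast, ← Real.rpow_add h₀,
      Nat.cast_ofNat, hexp]
  -- With `B = 2 N ‖v‖ ^ (1 - q)` the large values of `v`, where `B < t`, have `L¹` norm at most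
  -- `t / 2`, and `‖v‖ ^ 2 * B ^ (p - 2)` is a constant multiple of `‖v‖ ^ q`.
  calc ∫⁻ x, ENNReal.ofReal (‖(𝓕⁻ v : Lp F 2 (volume : Measure E)) x‖ ^ p)
      ≤ ENNReal.ofReal (4 * p / (p - 2)) * (ENNReal.ofReal ((2 * N) ^ (p - 2)) *
          ∫⁻ ξ, ENNReal.ofReal (‖v ξ‖ ^ q)) := by
        rw [← lintegral_const_mul' _ _ ENNReal.ofReal_ne_top, ← lintegral_congr hweight]
        exact lintegral_fourierInv_rpow_le_of_splitting hp v
          ((hvm.norm.measurable.pow_const _).const_mul _) (fun ξ => by positivity)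
          fun t ht => setLIntegral_enorm_le_of_lintegral_rpow_le hvm two_pos hN ht hv
    _ ≤ ENNReal.ofReal (4 * p / (p - 2)) * (ENNReal.ofReal ((2 * N) ^ (p - 2)) *
          ENNReal.ofReal N) := by gcongr
    _ = ENNReal.ofReal (4 * p / (p - 2) * 2 ^ (p - 2) * N ^ (p - 1)) := by
        rw [← ENNReal.ofReal_mul (by positivity), ← ENNReal.ofReal_mul (by positivity),
          Real.mul_rpow two_pos.le hN.le, show p - 1 = p - 2 + 1 by ring, Real.rpow_add hN,
          Real.rpow_one]
        ring_nf

theorem exists_eLpNorm_fourierInv_le {p q : ℝ≥0∞} [p.HolderConjugate q] (hp : 2 < p)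
    (hp' : p ≠ ∞) :
    ∃ C : ℝ≥0, ∀ v : Lp F 2 (volume : Measure E),
      eLpNorm (𝓕⁻ v : Lp F 2 (volume : Measure E)) p ≤ C * eLpNorm v q := by
  have hp₂ : 2 < p.toReal := by simpa using ENNReal.toReal_strict_mono hp' hp
  have hp₀ : 0 < p.toReal := by linarith
  have hpq : p.toReal.HolderConjugate q.toReal :=
    (ENNReal.HolderConjugate.toReal_iff (by linarith)).mpr ‹_›
  have hK : 0 < 4 * p.toReal / (p.toReal - 2) * 2 ^ (p.toReal - 2) := by
    have : 0 < p.toReal - 2 := by linarith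
    positivity
  set K : ℝ := 4 * p.toReal / (p.toReal - 2) * 2 ^ (p.toReal - 2)
  refine ⟨(K ^ p.toReal⁻¹).toNNReal, fun v => ?_⟩
  have hC : ((K ^ p.toReal⁻¹).toNNReal : ℝ≥0∞) ≠ 0 := by simpa using by positivity
  rw [← ENNReal.div_le_iff' hC ENNReal.coe_ne_top]
  refine le_of_forall_gt_imp_ge_of_dense fun m hm => ?_
  rcases eq_or_ne m ∞ with rfl | hm'
  · exact le_top
  have hm₀ : 0 < m.toReal := ENNReal.toReal_pos (pos_of_gt hm).ne' hm'
  have hvm : ∫⁻ ξ, ENNReal.ofReal (‖v ξ‖ ^ q.toReal) ≤ ENNReal.ofReal (m.toReal ^ q.toReal) := by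
    rw [← eLpNorm_rpow_toReal_eq_lintegral (ENNReal.toReal_pos_iff.mp hpq.symm.pos).1.ne'
        (ENNReal.toReal_pos_iff.mp hpq.symm.pos).2.ne,
      ← ENNReal.ofReal_rpow_of_pos hm₀, ENNReal.ofReal_toReal hm']
    gcongr
  rw [ENNReal.div_le_iff' hC ENNReal.coe_ne_top, ← ENNReal.rpow_le_rpow_iff hp₀,
    eLpNorm_rpow_toReal_eq_lintegral (pos_of_gt hp).ne' hp']
  refine (lintegral_fourierInv_rpow_le hpq hp₂ v (by positivity) hvm).trans_eq ?_
  have hexp : q.toReal * (p.toReal - 1) = p.toReal := by linarith [hpq.mul_eq_add]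
  rw [← ENNReal.ofReal_toReal hm', ← ENNReal.ofReal, ← ENNReal.ofReal_mul (by positivity),
    ENNReal.ofReal_rpow_of_pos (by positivity), ENNReal.toReal_ofReal hm₀.le,
    Real.mul_rpow (by positivity) hm₀.le, Real.rpow_inv_rpow hK.le hp₀.ne',
    ← Real.rpow_mul hm₀.le, hexp]

end HausdorffYoung

section SobolevWeight

variable {E : Type*} [NormedAddCommGroup E] [NormedSpace ℝ E] {b c s : ℝ}

/-- The weight `(1 + |c ξ|²)^{s/2}` of the `H^s` norm. The scale `c` accommodates two
normalizations: `c = 2π` gives `sobolevNorm`, while Mathlib's `MemSobolev` uses `c = 1`. -/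
def sobolevWeight (c s : ℝ) (ξ : E) : ℝ := (1 + ‖c • ξ‖ ^ 2) ^ (s / 2)

theorem sobolevWeight_pos (c s : ℝ) (ξ : E) : 0 < sobolevWeight c s ξ := by
  unfold sobolevWeight
  positivity

theorem one_le_sobolevWeight (hs : 0 ≤ s) (ξ : E) : 1 ≤ sobolevWeight c s ξ :=
  Real.one_le_rpow (by nlinarith [sq_nonneg ‖c • ξ‖]) (by positivity)

theorem continuous_sobolevWeight (c s : ℝ) : Continuous (sobolevWeight c s : E → ℝ) :=
  Continuous.rpow_const (by fun_prop) fun _ => Or.inl (by positivity)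

theorem sobolevWeight_le_mul (hc : c ≠ 0) (hs : 0 ≤ s) (ξ : E) :
    sobolevWeight b s ξ ≤ (1 + (b / c) ^ 2) ^ (s / 2) * sobolevWeight c s ξ := by
  unfold sobolevWeight
  rw [← Real.mul_rpow (by positivity) (by positivity)]
  gcongr
  simp only [norm_smul, mul_pow, Real.norm_eq_abs, sq_abs]
  have : (b / c) ^ 2 * c ^ 2 = b ^ 2 := by field_simp
  nlinarith [mul_nonneg (sq_nonneg c) (sq_nonneg ‖ξ‖), sq_nonneg (b / c)]

variable {F : Type*} [NormedAddCommGroup F] [NormedSpace ℝ F]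

theorem inv_sobolevWeight_smul_smul (c s : ℝ) (u : E → F) :
    (fun ξ : E => (sobolevWeight c s ξ)⁻¹) • (fun ξ => sobolevWeight c s ξ • u ξ) = u := by
  funext ξ
  exact inv_smul_smul₀ (sobolevWeight_pos c s ξ).ne' _

variable [MeasurableSpace E] [BorelSpace E] {μ : Measure E} {p r : ℝ≥0∞}

theorem memLp_sobolevWeight_smul_of_memLp (hc : c ≠ 0) (hs : 0 ≤ s) {u : E → F}
    (hu : AEStronglyMeasurable u μ) (h : MemLp (fun ξ => sobolevWeight c s ξ • u ξ) p μ) :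
    MemLp (fun ξ => sobolevWeight b s ξ • u ξ) p μ := by
  refine h.of_le_mul (c := (1 + (b / c) ^ 2) ^ (s / 2))
    ((continuous_sobolevWeight b s).aestronglyMeasurable.smul hu)
    (Eventually.of_forall fun ξ => ?_)
  rw [norm_smul, norm_smul, Real.norm_of_nonneg (sobolevWeight_pos b s ξ).le,
    Real.norm_of_nonneg (sobolevWeight_pos c s ξ).le, ← mul_assoc]
  gcongr
  exact sobolevWeight_le_mul hc hs ξ

theorem memLp_inv_sobolevWeight [FiniteDimensional ℝ E] [μ.IsAddHaarMeasure] (hc : c ≠ 0)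
    (hr₀ : r ≠ 0) (hr : r ≠ ∞) (hsr : Module.finrank ℝ E < s * r.toReal) :
    MemLp (fun ξ => (sobolevWeight c s ξ)⁻¹) r μ := by
  have hmeas : AEStronglyMeasurable (fun ξ : E => (sobolevWeight c s ξ)⁻¹) μ :=
    (continuous_sobolevWeight c s).measurable.inv.aestronglyMeasurable
  rw [← integrable_norm_rpow_iff hmeas hr₀ hr]
  refine ((integrable_rpow_neg_one_add_norm_sq (μ := μ) hsr).comp_smul hc).congr
    (Eventually.of_forall fun ξ => ?_)
  dsimp only [sobolevWeight]
  rw [Real.norm_of_nonneg (by positivity), ← Real.rpow_neg (by positivity),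
    ← Real.rpow_mul (by positivity)]
  ring_nf

end SobolevWeight

section MemSobolev

variable {E F : Type*} [NormedAddCommGroup E] [InnerProductSpace ℝ E] [FiniteDimensional ℝ E]
  [MeasurableSpace E] [BorelSpace E] [NormedAddCommGroup F] [InnerProductSpace ℂ F]
  [CompleteSpace F]

theorem smulLeftCLM_toTemperedDistribution_eq_iff {p q : ℝ≥0∞} [Fact (1 ≤ p)] [Fact (1 ≤ q)]
    {g : E → ℂ} (hg : g.HasTemperateGrowth) (f : Lp F p (volume : Measure E))
    (h : Lp F q (volume : Measure E)) :
    TemperedDistribution.smulLeftCLM F g (f : 𝓢'(E, F)) = (h : 𝓢'(E, F)) ↔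
      (fun ξ => g ξ • f ξ) =ᵐ[volume] h := by
  have happly (φ : 𝓢(E, ℂ)) : TemperedDistribution.smulLeftCLM F g (f : 𝓢'(E, F)) φ
      = ∫ ξ, φ ξ • g ξ • f ξ := by
    rw [TemperedDistribution.smulLeftCLM_apply_apply, Lp.toTemperedDistribution_apply]
    simp only [SchwartzMap.smulLeftCLM_apply_apply hg, smul_smul, smul_eq_mul, mul_comm]
  constructor <;> intro heq
  · refine ae_eq_of_forall_integral_schwartzMap_smul_eq
      (((Lp.memLp f).locallyIntegrable Fact.out).continuous_smul hg.1.continuous)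
      ((Lp.memLp h).locallyIntegrable Fact.out) fun φ => ?_
    rw [← happly, heq, Lp.toTemperedDistribution_apply]
  · ext φ
    rw [happly, Lp.toTemperedDistribution_apply]
    refine integral_congr_ae ?_
    filter_upwards [heq] with ξ hξ
    rw [hξ]

theorem memSobolev_iff_memLp_sobolevWeight_smul_fourier {c s : ℝ} (hc : c ≠ 0) (hs : 0 ≤ s)
    (f : Lp F 2 (volume : Measure E)) :
    TemperedDistribution.MemSobolev s 2 (f : 𝓢'(E, F)) ↔
      MemLp (fun ξ => sobolevWeight c s ξ • (𝓕 f : Lp F 2 (volume : Measure E)) ξ) 2 := by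
  have hm := Lp.aestronglyMeasurable (𝓕 f : Lp F 2 (volume : Measure E))
  have hgrowth : (fun ξ : E => (((1 + ‖ξ‖ ^ 2) ^ (s / 2) : ℝ) : ℂ)).HasTemperateGrowth := by
    fun_prop
  have hscale : MemLp (fun ξ => sobolevWeight c s ξ • (𝓕 f : Lp F 2 (volume : Measure E)) ξ) 2 ↔
      MemLp (fun ξ => (((1 + ‖ξ‖ ^ 2) ^ (s / 2) : ℝ) : ℂ) •
        (𝓕 f : Lp F 2 (volume : Measure E)) ξ) 2 := by
    have hone : (fun ξ => (((1 + ‖ξ‖ ^ 2) ^ (s / 2) : ℝ) : ℂ) •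
        (𝓕 f : Lp F 2 (volume : Measure E)) ξ)
        = fun ξ => sobolevWeight 1 s ξ • (𝓕 f : Lp F 2 (volume : Measure E)) ξ := by
      funext ξ
      rw [sobolevWeight, one_smul, Complex.coe_smul]
    rw [hone]
    exact ⟨memLp_sobolevWeight_smul_of_memLp hc hs hm,
      memLp_sobolevWeight_smul_of_memLp one_ne_zero hs hm⟩
  rw [hscale, TemperedDistribution.memSobolev_iff_exists_smulLeftCLM_fourier,
    Lp.fourier_toTemperedDistribution_eq]
  simp only [smulLeftCLM_toTemperedDistribution_eq_iff hgrowth]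
  exact ⟨fun ⟨h, heq⟩ => (memLp_congr_ae heq).mpr (Lp.memLp h),
    fun h => ⟨h.toLp, h.coeFn_toLp.symm⟩⟩

end MemSobolev

section SobolevNorm

variable {d : ℕ} {s : ℝ} {p : ℝ≥0∞}

theorem sobolevNorm_eq_eLpNorm (s : ℝ) (f : L2 d) :
    sobolevNorm s f
      = eLpNorm (fun ξ => sobolevWeight (2 * Real.pi) s ξ • (𝓕 f : L2 d) ξ) 2 := by
  rw [sobolevNorm, eLpNorm_eq_lintegral_rpow_enorm_toReal two_ne_zero ENNReal.ofNat_ne_top]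
  simp only [ENNReal.toReal_ofNat, ENNReal.rpow_ofNat, enorm_smul, mul_pow]
  congr! 4 with ξ
  rw [← ofReal_norm, Real.norm_of_nonneg (sobolevWeight_pos _ s ξ).le,
    ← ENNReal.ofReal_pow (sobolevWeight_pos _ s ξ).le, sobolevWeight,
    ← Real.rpow_mul_natCast (by positivity)]
  norm_num

theorem mem_Hs_iff_memLp (hs : 0 ≤ s) (f : L2 d) :
    f ∈ Hs d s ↔ MemLp (fun ξ => sobolevWeight (2 * Real.pi) s ξ • (𝓕 f : L2 d) ξ) 2 :=
  memSobolev_iff_memLp_sobolevWeight_smul_fourier Real.two_pi_pos.ne' hs f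

theorem mem_Hs_iff_sobolevNorm_lt_top (hs : 0 ≤ s) (f : L2 d) :
    f ∈ Hs d s ↔ sobolevNorm s f < ∞ := by
  rw [mem_Hs_iff_memLp hs, sobolevNorm_eq_eLpNorm, MemLp, and_iff_right]
  exact (continuous_sobolevWeight _ s).aestronglyMeasurable.smul (Lp.aestronglyMeasurable _)

theorem eLpNorm_fourier_le_sobolevNorm (hs : 0 ≤ s) (f : L2 d) :
    eLpNorm (𝓕 f : L2 d) 2 ≤ sobolevNorm s f := by
  rw [sobolevNorm_eq_eLpNorm]
  refine eLpNorm_mono fun ξ => ?_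
  rw [norm_smul]
  exact le_mul_of_one_le_left (norm_nonneg _)
    ((one_le_sobolevWeight hs ξ).trans (Real.le_norm_self _))

theorem eLpNorm_fourier_le_mul_sobolevNorm {q r : ℝ≥0∞} [r.HolderTriple 2 q] (s : ℝ) (f : L2 d) :
    eLpNorm (𝓕 f : L2 d) q
      ≤ eLpNorm (fun ξ : Space d => (sobolevWeight (2 * Real.pi) s ξ)⁻¹) r * sobolevNorm s f := by
  have hweight := continuous_sobolevWeight (E := Space d) (2 * Real.pi) s
  conv_lhs => rw [← inv_sobolevWeight_smul_smul (2 * Real.pi) s (𝓕 f : L2 d)]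
  rw [sobolevNorm_eq_eLpNorm]
  exact eLpNorm_smul_le_mul_eLpNorm
    (hweight.aestronglyMeasurable.smul (Lp.aestronglyMeasurable _))
    hweight.measurable.inv.aestronglyMeasurable

theorem toReal_mul_lt_of_lt_pStar [NeZero d] (hp : p < pStar s d) :
    p.toReal * (d - 2 * s) < 2 * d := by
  have hd : (0 : ℝ) < d := Nat.cast_pos.mpr (NeZero.pos d)
  rw [pStar] at hp
  split_ifs at hp with h
  · rwa [ENNReal.lt_ofReal_iff_toReal_lt hp.ne_top, lt_div_iff₀ (by linarith)] at hp
  · nlinarith [ENNReal.toReal_nonneg (a := p)]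

theorem exists_holderConjugate_holderTriple_of_lt_pStar [NeZero d]
    (hp : 2 < p) (hps : p < pStar s d) :
    ∃ q r : ℝ≥0∞, p.HolderConjugate q ∧ r.HolderTriple 2 q ∧ r ≠ 0 ∧ r ≠ ∞ ∧
      d < s * r.toReal := by
  have hlt := toReal_mul_lt_of_lt_pStar hps
  have hp₂ : 0 < p.toReal - 2 := by
    simpa using ENNReal.toReal_strict_mono hps.ne_top hp
  have hp₁ : 0 < p.toReal - 1 := by linarith
  have hp₀ : 0 < p.toReal := by linarith
  have hq := ENNReal.toReal_ofReal (div_nonneg hp₀.le hp₁.le)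
  have hr := ENNReal.toReal_ofReal (div_nonneg (mul_nonneg two_pos.le hp₀.le) hp₂.le)
  refine ⟨ENNReal.ofReal (p.toReal / (p.toReal - 1)),
    ENNReal.ofReal (2 * p.toReal / (p.toReal - 2)), .of_toReal ?_, .of_toReal ?_,
    by simpa using by positivity, ENNReal.ofReal_ne_top, ?_⟩
  · rw [hq]
    exact .conjExponent (by linarith)
  · rw [hq, hr, ENNReal.toReal_ofNat]
    refine ⟨?_, by positivity, by positivity⟩
    field_simp
    ring
  · rw [hr, mul_div_assoc', lt_div_iff₀ hp₂]
    linarith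

theorem exists_eLpNorm_le_mul_eLpNorm_fourier {q : ℝ≥0∞} [p.HolderConjugate q] (hp : 2 < p)
    (hp' : p ≠ ∞) : ∃ C : ℝ≥0, ∀ f : L2 d, eLpNorm f p ≤ C * eLpNorm (𝓕 f : L2 d) q := by
  obtain ⟨C, hC⟩ := exists_eLpNorm_fourierInv_le (E := Space d) (F := ℂ) (q := q) hp hp'
  refine ⟨C, fun f => ?_⟩
  have h := hC (𝓕 f)
  rwa [FourierTransform.fourierInv_fourier_eq] at h

theorem exists_eLpNorm_le_mul_sobolevNorm [NeZero d] (hp : 2 < p) (hps : p < pStar s d) :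
    ∃ C : ℝ≥0, ∀ f : L2 d, eLpNorm f p ≤ C * sobolevNorm s f := by
  obtain ⟨q, r, _, _, hr₀, hr, hsr⟩ := exists_holderConjugate_holderTriple_of_lt_pStar hp hps
  obtain ⟨A, hA⟩ := exists_eLpNorm_le_mul_eLpNorm_fourier (d := d) (q := q) hp hps.ne_top
  have hweight : MemLp (fun ξ : Space d => (sobolevWeight (2 * Real.pi) s ξ)⁻¹) r :=
    memLp_inv_sobolevWeight Real.two_pi_pos.ne' hr₀ hr (by simpa using hsr)
  refine ⟨A * (eLpNorm (fun ξ : Space d => (sobolevWeight (2 * Real.pi) s ξ)⁻¹) r).toNNReal,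
    fun f => ?_⟩
  rw [ENNReal.coe_mul, ENNReal.coe_toNNReal hweight.eLpNorm_ne_top, mul_assoc]
  exact (hA f).trans (by gcongr; exact eLpNorm_fourier_le_mul_sobolevNorm s f)

end SobolevNorm

section Vitali

variable {α F ι : Type*} {mα : MeasurableSpace α} {μ : Measure α} [NormedAddCommGroup F]
  [NormedSpace ℝ F] {h : α → ℝ} {M : ℝ≥0} {q r t : ℝ≥0∞} [r.HolderTriple t q]

theorem eLpNorm_indicator_smul_le {w : α → F} (hh : AEStronglyMeasurable h μ)
    (hw : AEStronglyMeasurable w μ) {S : Set α} (hS : MeasurableSet S) :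
    eLpNorm (S.indicator (h • w)) q μ ≤ eLpNorm (S.indicator h) r μ * eLpNorm w t μ := by
  have hsmul : S.indicator (h • w) = S.indicator h • w := Set.indicator_smul_left S h w
  rw [hsmul]
  exact eLpNorm_smul_le_mul_eLpNorm hw (hh.indicator hS)

theorem unifIntegrable_smul {w : ι → α → F} (hr₁ : 1 ≤ r) (hr : r ≠ ∞) (hh : MemLp h r μ)
    (hw : ∀ i, AEStronglyMeasurable (w i) μ) (hM : ∀ i, eLpNorm (w i) t μ ≤ M) :
    UnifIntegrable (fun i => h • w i) q μ := by
  intro ε hε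
  have hM₁ : 0 < (M : ℝ) + 1 := by positivity
  obtain ⟨δ, hδ, hsmall⟩ := hh.eLpNorm_indicator_le hr₁ hr (div_pos hε hM₁)
  refine ⟨δ, hδ, fun i S hS hμS => ?_⟩
  calc eLpNorm (S.indicator (h • w i)) q μ ≤ eLpNorm (S.indicator h) r μ * eLpNorm (w i) t μ :=
        eLpNorm_indicator_smul_le hh.1 (hw i) hS
    _ ≤ ENNReal.ofReal (ε / (M + 1)) * ENNReal.ofReal (M + 1) := by
        gcongr
        · exact hsmall S hS hμS
        · rw [ENNReal.ofReal_add M.coe_nonneg zero_le_one, ENNReal.ofReal_coe_nnreal]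
          exact (hM i).trans le_self_add
    _ = ENNReal.ofReal ε := by
        rw [← ENNReal.ofReal_mul (by positivity), div_mul_cancel₀ _ hM₁.ne']

theorem unifTight_smul {w : ι → α → F} (hr : r ≠ ∞) (hh : MemLp h r μ)
    (hw : ∀ i, AEStronglyMeasurable (w i) μ) (hM : ∀ i, eLpNorm (w i) t μ ≤ M) :
    UnifTight (fun i => h • w i) q μ := by
  intro ε hε
  obtain ⟨S, hS, hμS, hsmall⟩ := hh.exists_eLpNorm_indicator_compl_lt hr
    (ε := ε / (M + 1 : ℝ≥0)) (by simpa using hε.ne')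
  refine ⟨S, hμS.ne, fun i => ?_⟩
  calc eLpNorm (Sᶜ.indicator (h • w i)) q μ ≤ eLpNorm (Sᶜ.indicator h) r μ * eLpNorm (w i) t μ :=
        eLpNorm_indicator_smul_le hh.1 (hw i) hS.compl
    _ ≤ ε / (M + 1 : ℝ≥0) * (M + 1 : ℝ≥0) := by
        gcongr
        exact (hM i).trans (by simp)
    _ ≤ ε := ENNReal.mul_le_of_le_div le_rfl

theorem tendsto_eLpNorm_smul_sub_of_ae_tendsto {w : ℕ → α → F} {g : α → F} (hq₁ : 1 ≤ q)
    (hr : r ≠ ∞) (hh : MemLp h r μ) (hw : ∀ n, AEStronglyMeasurable (w n) μ)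
    (hM : ∀ n, eLpNorm (w n) t μ ≤ M)
    (hlim : ∀ᵐ x ∂μ, Tendsto (fun n => h x • w n x) atTop (𝓝 (g x))) :
    Tendsto (fun n => eLpNorm (h • w n - g) q μ) atTop (𝓝 0) := by
  have hmeas (n : ℕ) : AEStronglyMeasurable (h • w n) μ := hh.1.smul (hw n)
  have hg : MemLp g q μ := ⟨aestronglyMeasurable_of_tendsto_ae _ hmeas hlim,
    (Lp.eLpNorm_le_of_ae_tendsto (Eventually.of_forall fun n =>
      (eLpNorm_smul_le_mul_eLpNorm (hw n) hh.1).trans (by gcongr; exact hM n)) hmeas hlim).trans_lt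
      (ENNReal.mul_lt_top hh.2 ENNReal.coe_lt_top)⟩
  have hqr : q ≤ r := ENNReal.HolderTriple.le r t q
  have hq : q ≠ ∞ := ne_top_of_le_ne_top hr hqr
  exact tendsto_Lp_of_tendsto_ae hq₁ hq hmeas hg (unifIntegrable_smul (hq₁.trans hqr) hr hh hw hM)
    (unifTight_smul hr hh hw hM) hlim

end Vitali

section Helly

theorem exists_subseq_tendsto_of_antitone {β : Type*} [CompleteLinearOrder β] [TopologicalSpace β]
    [OrderTopology β] [FirstCountableTopology β] (U : ℕ → ℝ → β) (hU : ∀ k, Antitone (U k)) :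
    ∃ φ : ℕ → ℕ, StrictMono φ ∧ ∃ V : ℝ → β, Antitone V ∧
      ∀ r, ContinuousAt V r → Tendsto (fun m => U (φ m) r) atTop (𝓝 (V r)) := by
  obtain ⟨L, φ, hφ, hL⟩ := CompactSpace.tendsto_subseq fun (k : ℕ) (q : ℚ) => U k q
  rw [tendsto_pi_nhds] at hL
  set V : ℝ → β := fun r => ⨅ (q : ℚ) (_ : (q : ℝ) < r), L q
  refine ⟨φ, hφ, V, fun r r' h => le_iInf₂ fun q hq => iInf₂_le q (hq.trans_le h), fun r hr => ?_⟩
  refine tendsto_order.mpr ⟨fun b hb => ?_, fun b hb => ?_⟩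
  · obtain ⟨r', hr', hlt⟩ : ∃ r', b < V r' ∧ r < r' :=
      (((hr.eventually (lt_mem_nhds hb)).filter_mono nhdsWithin_le_nhds).and
        (self_mem_nhdsWithin (s := Ioi r))).exists
    obtain ⟨q, hrq, hqr'⟩ := exists_rat_btwn hlt
    filter_upwards [(hL q).eventually (lt_mem_nhds (hr'.trans_le (iInf₂_le q hqr')))] with m hm
    exact hm.trans_le (hU _ hrq.le)
  · obtain ⟨q, hqr, hqb⟩ : ∃ q : ℚ, ∃ _ : (q : ℝ) < r, L q < b := by
      simpa only [V, iInf_lt_iff] using hb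
    filter_upwards [(hL q).eventually (gt_mem_nhds hqb)] with m hm
    exact (hU _ hqr.le).trans_lt hm

end Helly

section RadialProfile

theorem ae_continuousAt_norm_of_antitone {E β : Type*} [NormedAddCommGroup E] [NormedSpace ℝ E]
    [FiniteDimensional ℝ E] [Nontrivial E] [MeasurableSpace E] [BorelSpace E] (μ : Measure E)
    [μ.IsAddHaarMeasure] [LinearOrder β] [TopologicalSpace β] [OrderTopology β]
    [SecondCountableTopology β] {U : ℝ → β} (hU : Antitone U) :
    ∀ᵐ x ∂μ, ContinuousAt U ‖x‖ := by
  have hcover : {x : E | ¬ ContinuousAt U ‖x‖} ⊆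
      ⋃ r ∈ {r | ¬ ContinuousAt U r}, Metric.sphere (0 : E) r := fun x hx => by
    simpa using hx
  refine measure_mono_null hcover ?_
  rw [measure_biUnion_null_iff hU.countable_not_continuousAt]
  exact fun r _ => Measure.addHaar_sphere μ 0 r

variable {d : ℕ} {U : ℝ → ℝ≥0∞} {p : ℝ≥0∞}

/-- The profiles `U` of radially decreasing functions `x ↦ U ‖x‖`. The value `∞` is allowed for
`r ≤ 0` because the rearrangement of an unbounded function is infinite at the origin. -/
structure IsProfile (U : ℝ → ℝ≥0∞) : Prop where
  antitone : Antitone U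
  ne_top : ∀ r, 0 < r → U r ≠ ∞

/-- The radial function `x ↦ U ‖x‖` on `ℝ^d`, regarded as complex-valued. -/
def radial (d : ℕ) (U : ℝ → ℝ≥0∞) (x : Space d) : ℂ := ((U ‖x‖).toReal : ℂ)

theorem measurable_radial (d : ℕ) (hU : Antitone U) : Measurable (radial d U) :=
  Complex.measurable_ofReal.comp (hU.measurable.comp measurable_norm).ennreal_toReal

namespace IsProfile

theorem enorm_radial (hU : IsProfile U) {x : Space d} (hx : x ≠ 0) :
    ‖radial d U x‖ₑ = U ‖x‖ := by
  rw [radial, ← ofReal_norm, Complex.norm_real, Real.norm_of_nonneg ENNReal.toReal_nonneg,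
    ENNReal.ofReal_toReal (hU.ne_top _ (norm_pos_iff.mpr hx))]

theorem mul_volume_ball_rpow_le_eLpNorm [NeZero d] (hU : IsProfile U) (hp₀ : p ≠ 0) (hp : p ≠ ∞)
    (r : ℝ) : U r * volume (Metric.ball (0 : Space d) r) ^ (1 / p.toReal)
      ≤ eLpNorm (radial d U) p := by
  rw [← enorm_eq_self (U r), ← eLpNorm_indicator_const measurableSet_ball hp₀ hp]
  refine eLpNorm_mono_enorm_ae ?_
  filter_upwards [Measure.ae_ne volume (0 : Space d)] with x hx
  rw [enorm_eq_self, hU.enorm_radial hx]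
  exact indicator_le (fun y hy => hU.antitone (mem_ball_zero_iff.mp hy).le) x

end IsProfile

theorem exists_subseq_tendsto_radial [NeZero d] {U : ℕ → ℝ → ℝ≥0∞} (hU : ∀ k, IsProfile (U k))
    (hp₀ : p ≠ 0) (hp : p ≠ ∞) {M : ℝ≥0} (hM : ∀ k, eLpNorm (radial d (U k)) p ≤ M) :
    ∃ φ : ℕ → ℕ, StrictMono φ ∧ ∃ V : ℝ → ℝ≥0∞, IsProfile V ∧ MemLp (radial d V) p ∧
      ∀ᵐ x, Tendsto (fun m => radial d (U (φ m)) x) atTop (𝓝 (radial d V x)) := by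
  obtain ⟨φ, hφ, V, hVanti, hlim⟩ :=
    exists_subseq_tendsto_of_antitone U fun k => (hU k).antitone
  have hV : IsProfile V := by
    refine ⟨hVanti, fun r hr => ?_⟩
    obtain ⟨r', hr', hr'₀, hr'r⟩ :=
      (hVanti.countable_not_continuousAt.dense_compl ℝ).exists_between hr
    set b := volume (Metric.ball (0 : Space d) r') ^ (1 / p.toReal)
    have hb : 0 < b := ENNReal.rpow_pos (Metric.measure_ball_pos _ _ hr'₀) measure_ball_ne_top
    have hb' : b ≠ ∞ := ENNReal.rpow_ne_top_of_nonneg (by positivity) measure_ball_ne_top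
    have hbound (k : ℕ) : U k r' ≤ M / b := by
      rw [ENNReal.le_div_iff_mul_le (.inl hb.ne') (.inl hb')]
      exact ((hU k).mul_volume_ball_rpow_le_eLpNorm hp₀ hp r').trans (hM k)
    have hVr' : V r' ≤ M / b :=
      le_of_tendsto' (hlim r' (not_not.mp hr')) fun m => hbound (φ m)
    exact ne_top_of_le_ne_top (ENNReal.div_ne_top ENNReal.coe_ne_top hb.ne')
      ((hVanti hr'r.le).trans hVr')
  have hae : ∀ᵐ x : Space d, Tendsto (fun m => radial d (U (φ m)) x) atTop (𝓝 (radial d V x)) := by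
    filter_upwards [Measure.ae_ne volume 0, ae_continuousAt_norm_of_antitone volume hVanti]
      with x hx hcont
    exact (Complex.continuous_ofReal.tendsto _).comp
      ((ENNReal.tendsto_toReal (hV.ne_top _ (norm_pos_iff.mpr hx))).comp (hlim _ hcont))
  exact ⟨φ, hφ, V, hV, ⟨(measurable_radial d hVanti).aestronglyMeasurable,
    (Lp.eLpNorm_le_of_ae_tendsto (Eventually.of_forall fun m => hM (φ m))
      (fun m => (measurable_radial d (hU _).antitone).aestronglyMeasurable) hae).trans_lt
      ENNReal.coe_lt_top⟩, hae⟩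

end RadialProfile

section Rearrangement

theorem measure_lt_norm_ne_top {α F : Type*} {mα : MeasurableSpace α} {μ : Measure α}
    [NormedAddCommGroup F] {g : α → F} {p : ℝ≥0∞} (hg : MemLp g p μ) (hp₀ : p ≠ 0) (hp : p ≠ ∞)
    {t : ℝ} (ht : 0 < t) : μ {x | t < ‖g x‖} ≠ ∞ := by
  lift t to ℝ≥0 using ht.le
  exact ((measure_mono fun x (hx : (t : ℝ) < ‖g x‖) => NNReal.coe_le_coe.mp hx.le).trans_lt
    (hg.meas_ge_lt_top hp₀ hp (NNReal.coe_pos.mp ht).ne')).ne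

theorem tendsto_measure_lt_norm_atTop {α F : Type*} {mα : MeasurableSpace α} {μ : Measure α}
    [NormedAddCommGroup F] {g : α → F} (hg : AEStronglyMeasurable g μ)
    (hfin : ∃ t : ℝ, μ {x | t < ‖g x‖} ≠ ∞) :
    Tendsto (fun t : ℝ => μ {x | t < ‖g x‖}) atTop (𝓝 0) := by
  have hempty : ⋂ t : ℝ, {x | t < ‖g x‖} = ∅ :=
    eq_empty_of_forall_notMem fun x hx =>
      lt_irrefl ‖g x‖ (mem_iInter.mp hx ‖g x‖ : ‖g x‖ < ‖g x‖)
  simpa only [hempty, measure_empty] using! tendsto_measure_iInter_atTop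
    (fun t => nullMeasurableSet_lt aemeasurable_const hg.norm.aemeasurable)
    (fun t t' h x (hx : t' < ‖g x‖) => h.trans_lt hx) hfin

theorem volume_setOf_pos_and_ofReal_lt (c : ℝ≥0∞) :
    volume {t : ℝ | 0 < t ∧ ENNReal.ofReal t < c} = c := by
  induction c with
  | top => simpa only [ENNReal.ofReal_lt_top, and_true] using! Real.volume_Ioi (a := 0)
  | coe c =>
    have : {t : ℝ | 0 < t ∧ ENNReal.ofReal t < c} = Ioo 0 (c : ℝ) := by
      ext t
      exact and_congr_right fun ht => ENNReal.ofReal_lt_coe_iff ht.le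
    rw [this, Real.volume_Ioo, sub_zero, ENNReal.ofReal_coe_nnreal]

variable {d : ℕ} {U : ℝ → ℝ≥0∞} {g : Space d → ℂ}

/-- The profile of the symmetric-decreasing rearrangement of `g`: by the layer-cake formula, `g^*`
at distance `r` from the origin is the measure of the levels `t` with `|{|g| > t}| > |B_r|`. -/
def rearrProfile (g : Space d → ℂ) (r : ℝ) : ℝ≥0∞ :=
  volume {t : ℝ | 0 < t ∧ volume (Metric.ball (0 : Space d) r) < volume {y | t < ‖g y‖}}

theorem rearrProfile_congr_ae {g' : Space d → ℂ} (h : g =ᵐ[volume] g') :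
    rearrProfile g = rearrProfile g' := by
  have hlevel (t : ℝ) : volume {y | t < ‖g y‖} = volume {y | t < ‖g' y‖} := by
    refine measure_congr ?_
    filter_upwards [h] with y hy
    exact congrArg (t < ‖·‖) hy
  funext r
  simp only [rearrProfile, hlevel]

theorem isProfile_rearrProfile (hg : AEStronglyMeasurable g)
    (hfin : ∃ t : ℝ, volume {y | t < ‖g y‖} ≠ ∞) : IsProfile (rearrProfile g) := by
  refine ⟨fun r r' h => measure_mono fun t ht =>
    ⟨ht.1, (measure_mono (Metric.ball_subset_ball h)).trans_lt ht.2⟩, fun r hr => ?_⟩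
  obtain ⟨T, hT⟩ := ((tendsto_measure_lt_norm_atTop hg hfin).eventually
    (gt_mem_nhds (Metric.measure_ball_pos volume (0 : Space d) hr))).exists
  refine ((measure_mono fun t ht => ?_).trans_lt (measure_Ioc_lt_top (a := (0 : ℝ)) (b := T))).ne
  refine ⟨ht.1, le_of_not_gt fun hTt => (ht.2.trans_le ?_).not_gt hT⟩
  exact measure_mono fun y (hy : t < ‖g y‖) => hTt.trans hy

variable [NeZero d]

theorem volume_ball_lt_volume_ball_iff {r r' : ℝ} (hr : 0 ≤ r) (hr' : 0 ≤ r') :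
    volume (Metric.ball (0 : Space d) r) < volume (Metric.ball (0 : Space d) r') ↔ r < r' := by
  rw [Measure.addHaar_ball _ _ hr, Measure.addHaar_ball _ _ hr', finrank_euclideanSpace_fin,
    ENNReal.mul_lt_mul_iff_left (Metric.measure_ball_pos _ _ one_pos).ne' measure_ball_ne_top,
    ENNReal.ofReal_lt_ofReal_iff_of_nonneg (by positivity),
    pow_lt_pow_iff_left₀ hr hr' (NeZero.ne d)]

theorem lt_ballRadius_iff {A : Set (Space d)} (hA : volume A ≠ ∞) {r : ℝ} (hr : 0 ≤ r) :
    r < ballRadius A ↔ volume (Metric.ball (0 : Space d) r) < volume A := by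
  have hR : 0 ≤ ballRadius A := Real.rpow_nonneg ENNReal.toReal_nonneg _
  rw [← volume_ball_lt_volume_ball_iff (d := d) hr hR]
  exact iff_of_eq (congrArg _ (volume_setRearr A hA))

theorem symmRearr_eq_rearrProfile (hfin : ∀ t : ℝ, 0 < t → volume {y | t < ‖g y‖} ≠ ∞)
    (x : Space d) : symmRearr g x = rearrProfile g ‖x‖ := by
  have hmeas : MeasurableSet {t : ℝ | volume (Metric.ball (0 : Space d) ‖x‖) <
      volume {y | t < ‖g y‖}} :=
    measurableSet_lt measurable_const (Antitone.measurable fun t t' h =>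
      measure_mono fun y (hy : t' < ‖g y‖) => h.trans_lt hy)
  have hlevel (t : ℝ) (ht : 0 < t) : (setRearr {y | t < ‖g y‖}).indicator (1 : Space d → ℝ≥0∞) x
      = {t : ℝ | volume (Metric.ball (0 : Space d) ‖x‖) <
          volume {y | t < ‖g y‖}}.indicator 1 t := by
    simp only [indicator, setRearr, mem_ball_zero_iff, mem_ofPred_eq,
      lt_ballRadius_iff (hfin t ht) (norm_nonneg x), Pi.one_apply]
  rw [symmRearr, setLIntegral_congr_fun measurableSet_Ioi hlevel, lintegral_indicator_one hmeas,
    Measure.restrict_apply hmeas, inter_comm]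
  rfl

theorem IsProfile.setOf_lt_norm_radial_ae_eq (hU : IsProfile U) {t : ℝ} (ht : 0 < t) :
    {y : Space d | t < ‖radial d U y‖} =ᵐ[volume] {y | ENNReal.ofReal t < U ‖y‖} := by
  filter_upwards [Measure.ae_ne volume (0 : Space d)] with y hy
  refine propext ?_
  change t < ‖radial d U y‖ ↔ ENNReal.ofReal t < U ‖y‖
  rw [← hU.enorm_radial hy, ← ofReal_norm, ENNReal.ofReal_lt_ofReal_iff_of_nonneg ht.le]

theorem IsProfile.rearrProfile_radial (hU : IsProfile U) {r : ℝ} (hr : 0 ≤ r)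
    (hc : ContinuousAt U r) : rearrProfile (radial d U) r = U r := by
  refine le_antisymm ?_ ?_
  · conv_rhs => rw [← volume_setOf_pos_and_ofReal_lt (U r)]
    refine measure_mono fun t ⟨ht, hlt⟩ => ⟨ht, lt_of_not_ge fun hle => hlt.not_ge ?_⟩
    rw [measure_congr (hU.setOf_lt_norm_radial_ae_eq ht)]
    refine measure_mono fun y (hy : ENNReal.ofReal t < U ‖y‖) => mem_ball_zero_iff.mpr ?_
    exact lt_of_not_ge fun h => hy.not_ge ((hU.antitone h).trans hle)
  · refine le_of_tendsto (hc.mono_left nhdsWithin_le_nhds : Tendsto U (𝓝[>] r) (𝓝 (U r))) ?_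
    filter_upwards [self_mem_nhdsWithin] with r' (hr' : r < r')
    rw [← volume_setOf_pos_and_ofReal_lt (U r')]
    refine measure_mono fun t ⟨ht, hlt⟩ => ⟨ht, ?_⟩
    rw [measure_congr (hU.setOf_lt_norm_radial_ae_eq ht)]
    refine ((volume_ball_lt_volume_ball_iff hr (hr.trans hr'.le)).mpr hr').trans_le ?_
    exact measure_mono fun y hy => hlt.trans_le (hU.antitone (mem_ball_zero_iff.mp hy).le)

theorem fourier_fourierRearr_ae_eq (f : L2 d) :
    (𝓕 (fourierRearr f) : L2 d) =ᵐ[volume] radial d (rearrProfile (𝓕 f : L2 d)) := by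
  rw [fourierRearr, FourierTransform.fourier_fourierInv_eq]
  filter_upwards [(memLp_symmRearr (𝓕 f : L2 d) (Lp.memLp _)).coeFn_toLp] with ξ hξ
  rw [hξ, symmRearr_eq_rearrProfile fun t ht =>
    measure_lt_norm_ne_top (Lp.memLp _) two_ne_zero ENNReal.ofNat_ne_top ht, radial]

theorem eq_fourierRearr_iff (f : L2 d) :
    f = fourierRearr f ↔ ∃ U, IsProfile U ∧ (𝓕 f : L2 d) =ᵐ[volume] radial d U := by
  constructor
  · intro hf
    refine ⟨rearrProfile (𝓕 f : L2 d), isProfile_rearrProfile (Lp.aestronglyMeasurable _)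
      ⟨1, measure_lt_norm_ne_top (Lp.memLp _) two_ne_zero ENNReal.ofNat_ne_top one_pos⟩, ?_⟩
    conv_lhs => rw [hf]
    exact fourier_fourierRearr_ae_eq f
  · rintro ⟨U, hU, hfU⟩
    refine (Lp.fourierTransformₗᵢ (Space d) ℂ).injective (Lp.ext ?_)
    refine EventuallyEq.trans hfU (EventuallyEq.trans ?_ (fourier_fourierRearr_ae_eq f).symm)
    rw [rearrProfile_congr_ae hfU]
    filter_upwards [ae_continuousAt_norm_of_antitone volume hU.antitone] with ξ hξ
    rw [radial, radial, hU.rearrProfile_radial (norm_nonneg ξ) hξ]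

end Rearrangement

section Compactness

variable {d : ℕ} {s : ℝ} {p : ℝ≥0∞} {M : ℝ≥0} {f : ℕ → L2 d} {g : L2 d}

theorem sobolevNorm_le_of_ae_tendsto_fourier (hM : ∀ k, sobolevNorm s (f k) ≤ M)
    (hlim : ∀ᵐ ξ, Tendsto (fun k => (𝓕 (f k) : L2 d) ξ) atTop (𝓝 ((𝓕 g : L2 d) ξ))) :
    sobolevNorm s g ≤ M := by
  simp only [sobolevNorm_eq_eLpNorm] at hM ⊢
  refine Lp.eLpNorm_le_of_ae_tendsto (u := atTop) (Eventually.of_forall hM) (fun k =>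
    (continuous_sobolevWeight _ s).aestronglyMeasurable.smul (Lp.aestronglyMeasurable _)) ?_
  filter_upwards [hlim] with ξ hξ
  exact hξ.const_smul _

theorem tendsto_eLpNorm_fourier_sub {q r : ℝ≥0∞} [r.HolderTriple 2 q] (hq : 1 ≤ q) (hr₀ : r ≠ 0)
    (hr : r ≠ ∞) (hsr : d < s * r.toReal) (hM : ∀ k, sobolevNorm s (f k) ≤ M)
    (hlim : ∀ᵐ ξ, Tendsto (fun k => (𝓕 (f k) : L2 d) ξ) atTop (𝓝 ((𝓕 g : L2 d) ξ))) :
    Tendsto (fun k => eLpNorm (𝓕 (f k - g) : L2 d) q) atTop (𝓝 0) := by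
  have hweight : MemLp (fun ξ : Space d => (sobolevWeight (2 * Real.pi) s ξ)⁻¹) r :=
    memLp_inv_sobolevWeight Real.two_pi_pos.ne' hr₀ hr (by simpa using hsr)
  have hvitali := tendsto_eLpNorm_smul_sub_of_ae_tendsto (t := 2) (g := (𝓕 g : L2 d)) (M := M)
    (w := fun k ξ => sobolevWeight (2 * Real.pi) s ξ • (𝓕 (f k) : L2 d) ξ) hq hr hweight
    (fun k => (continuous_sobolevWeight _ s).aestronglyMeasurable.smul (Lp.aestronglyMeasurable _))
    (fun k => (sobolevNorm_eq_eLpNorm s (f k)).symm.trans_le (hM k)) (by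
      filter_upwards [hlim] with ξ hξ
      simpa only [inv_smul_smul₀ (sobolevWeight_pos _ s ξ).ne'] using hξ)
  simp only [inv_sobolevWeight_smul_smul] at hvitali
  refine hvitali.congr fun k => eLpNorm_congr_ae ?_
  have hsub : (𝓕 (f k - g) : L2 d) = 𝓕 (f k) - 𝓕 g :=
    (Lp.fourierTransformₗᵢ (Space d) ℂ).map_sub _ _
  rw [hsub]
  exact (Lp.coeFn_sub _ _).symm

variable [NeZero d]

theorem memLp_of_mem_Hs (hs : 0 ≤ s) (hp : 2 < p) (hps : p < pStar s d) (hg : g ∈ Hs d s) :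
    MemLp g p := by
  obtain ⟨C, hC⟩ := exists_eLpNorm_le_mul_sobolevNorm hp hps
  exact ⟨Lp.aestronglyMeasurable g, (hC g).trans_lt
    (ENNReal.mul_lt_top ENNReal.coe_lt_top ((mem_Hs_iff_sobolevNorm_lt_top hs g).mp hg))⟩

theorem tendsto_eLpNorm_sub_of_ae_tendsto_fourier (hp : 2 < p) (hps : p < pStar s d)
    (hM : ∀ k, sobolevNorm s (f k) ≤ M)
    (hlim : ∀ᵐ ξ, Tendsto (fun k => (𝓕 (f k) : L2 d) ξ) atTop (𝓝 ((𝓕 g : L2 d) ξ))) :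
    Tendsto (fun k => eLpNorm (f k - g : L2 d) p) atTop (𝓝 0) := by
  obtain ⟨q, r, _, _, hr₀, hr, hsr⟩ := exists_holderConjugate_holderTriple_of_lt_pStar hp hps
  obtain ⟨C, hC⟩ := exists_eLpNorm_le_mul_eLpNorm_fourier (d := d) (q := q) hp hps.ne_top
  have hfourier : Tendsto (fun k => eLpNorm (𝓕 (f k - g) : L2 d) q) atTop (𝓝 0) :=
    tendsto_eLpNorm_fourier_sub (ENNReal.HolderConjugate.one_le q p) hr₀ hr hsr hM hlim
  have hmul : Tendsto (fun k => C * eLpNorm (𝓕 (f k - g) : L2 d) q) atTop (𝓝 0) := by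
    simpa using! ENNReal.Tendsto.const_mul hfourier (Or.inr (ENNReal.coe_ne_top (r := C)))
  exact tendsto_of_tendsto_of_tendsto_of_le_of_le tendsto_const_nhds hmul
    (fun _ => zero_le) fun k => hC _

theorem exists_subseq_ae_tendsto_fourier (hf : ∀ k, f k = fourierRearr (f k))
    (hM : ∀ k, eLpNorm (𝓕 (f k) : L2 d) 2 ≤ M) :
    ∃ φ : ℕ → ℕ, StrictMono φ ∧ ∃ g : L2 d, g = fourierRearr g ∧
      ∀ᵐ ξ, Tendsto (fun m => (𝓕 (f (φ m)) : L2 d) ξ) atTop (𝓝 ((𝓕 g : L2 d) ξ)) := by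
  choose U hU hfU using fun k => (eq_fourierRearr_iff (f k)).mp (hf k)
  obtain ⟨φ, hφ, V, hV, hVL, hlim⟩ := exists_subseq_tendsto_radial hU two_ne_zero
    ENNReal.ofNat_ne_top fun k => (eLpNorm_congr_ae (hfU k)).symm.trans_le (hM k)
  have hgV : (𝓕 (𝓕⁻ hVL.toLp : L2 d) : L2 d) =ᵐ[volume] radial d V := by
    rw [FourierTransform.fourier_fourierInv_eq]
    exact hVL.coeFn_toLp
  refine ⟨φ, hφ, 𝓕⁻ hVL.toLp, (eq_fourierRearr_iff _).mpr ⟨V, hV, hgV⟩, ?_⟩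
  filter_upwards [hlim, hgV, ae_all_iff.mpr hfU] with ξ hξ hgξ hfξ
  simpa only [hgξ, hfξ] using hξ

theorem exists_subseq_tendsto_of_mem_HsSharp (hs : 0 ≤ s) (hf : ∀ k, f k ∈ HsSharp d s)
    (hM : ∀ k, sobolevNorm s (f k) ≤ M) :
    ∃ φ : ℕ → ℕ, StrictMono φ ∧ ∃ g ∈ HsSharp d s, ∀ p : ℝ≥0∞, 2 < p → p < pStar s d →
      MemLp g p ∧ Tendsto (fun m => eLpNorm (fun x => f (φ m) x - g x) p) atTop (𝓝 0) := by
  obtain ⟨φ, hφ, g, hg, hlim⟩ := exists_subseq_ae_tendsto_fourier (fun k => (hf k).2)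
    fun k => (eLpNorm_fourier_le_sobolevNorm hs (f k)).trans (hM k)
  have hgs : g ∈ Hs d s := (mem_Hs_iff_sobolevNorm_lt_top hs g).mpr
    ((sobolevNorm_le_of_ae_tendsto_fourier (fun m => hM (φ m)) hlim).trans_lt ENNReal.coe_lt_top)
  refine ⟨φ, hφ, g, ⟨hgs, hg⟩, fun p hp hps => ⟨memLp_of_mem_Hs hs hp hps hgs, ?_⟩⟩
  exact (tendsto_eLpNorm_sub_of_ae_tendsto_fourier hp hps (fun m => hM (φ m)) hlim).congr
    fun m => eLpNorm_congr_ae (Lp.coeFn_sub _ _)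

end Compactness

end FourierRearr

end

theorem mainTheorem7 (d : ℕ) [NeZero d] (s : ℝ) (hs : 0 < s) :
    (∀ p : ℝ≥0∞, 2 < p → p < FourierRearr.pStar s d →
      FourierRearr.CompactlyEmbedded s p (FourierRearr.HsSharp d s)) ∧
    ∀ f : ℕ → FourierRearr.L2 d, (∀ k, f k ∈ FourierRearr.HsSharp d s) →
      (∃ M : ℝ≥0, ∀ k, FourierRearr.sobolevNorm s (f k) ≤ M) →
      ∃ φ : ℕ → ℕ, StrictMono φ ∧ ∃ g ∈ FourierRearr.HsSharp d s,
        ∀ p : ℝ≥0∞, 2 < p → p < FourierRearr.pStar s d →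
          MemLp g p volume ∧
          Tendsto (fun m => eLpNorm (fun x => f (φ m) x - g x) p volume) atTop (𝓝 0) := by
  refine ⟨fun p hp hps => ⟨fun f hf => FourierRearr.memLp_of_mem_Hs hs.le hp hps hf.1, ?_, ?_⟩,
    fun f hf ⟨M, hM⟩ => FourierRearr.exists_subseq_tendsto_of_mem_HsSharp hs.le hf hM⟩
  · obtain ⟨C, hC⟩ := FourierRearr.exists_eLpNorm_le_mul_sobolevNorm (d := d) hp hps
    exact ⟨C, fun f _ g _ => hC (f - g)⟩
  · intro f hf ⟨M, hM⟩
    obtain ⟨φ, hφ, g, -, hg⟩ :=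
      FourierRearr.exists_subseq_tendsto_of_mem_HsSharp hs.le hf hM
    exact ⟨φ, hφ, g, hg p hp hps⟩
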